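/- Let $A\in\mathbb{R}^{n\times n}$, $b,c\in\mathbb{R}^n$, and let $G=[g_{ij}]\in\mathbb{R}^{N\times N}$ satisfy $g_{ij}\ge 0$ for all $i,j$ (nonnegativity) and $\mathrm{Tr}(G^2)=0$ (nonreciprocity). Assume that $I_N\otimes A+G\otimes bc^{T}$ is Hurwitz. Consider, on a probability space, the network $$\dot x_i(t)=Ax_i(t)+b\Big(\sum_{j=1}^N g_{ij}y_j(t)+w_i(t)\Big),\qquad y_i(t)=c^{T}x_i(t),\qquad 1\le i\le N,\ t\in\mathbb{R},$$ where the states are second-order processes, the derivative is taken in mean square, and the outputs are in steady state: for all $i,j$ the cross-correlation $R_{y_iy_j}(\tau)=\mathbb{E}(y_i(t)y_j(t-\tau))$ does not depend on $t$. Assume: (A1) $w_1,\dots,w_N$ are mutually uncorrelated, zero-mean, wide-sense stationary processes with the same autocorrelation function $R_w(\tau)$, so that $\mathbb{E}(w_i(t)w_j(t'))=0$ for $i\ne j$ and all $t,t'$; (A2) $R_w$ is integrable, and for some $\Omega>0$ the input power spectral density $S_w(\omega)=\int_{\mathbb{R}}R_w(\tau)e^{-\mathbf{j}\omega\tau}\,d\tau$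 is positive for all $\omega\in(-\Omega,\Omega)$. Let $h(\mathbf{j}\omega)=c^{T}(\mathbf{j}\omega I_n-A)^{-1}b$ be the nodal transfer function. Then every $R_{y_iy_j}$ is integrable. Let $\mathbf{S}(\omega)=[S_{y_iy_j}(\omega)]$, with $S_{y_iy_j}(\omega)=\int_{\mathbb{R}}R_{y_iy_j}(\tau)e^{-\mathbf{j}\omega\tau}\,d\tau$. For every $\omega\in(-\Omega,\Omega)$ such that $h(\mathbf{j}\omega)$ is defined and nonzero and $\mathrm{Im}\{h^{-1}(\mathbf{j}\omega)\}\neq 0$, the matrix $\mathbf{S}(\omega)$ is invertible, $$G-G^{T}=\frac{S_w(\omega)}{\mathrm{Im}\{h^{-1}(\mathbf{j}\omega)\}}\,\mathrm{Im}\{\mathbf{S}^{-1}(\omega)\},$$ and $$g_{ij}=\max\left\{S_w(\omega)\,\frac{[\mathrm{Im}\{\mathbf{S}^{-1}(\omega)\}]_{ij}}{\mathrm{Im}\{h^{-1}(\mathbf{j}\omega)\}},\,0\right\}\qquad\text{for } 1\le i\ne j\le N.$$ -/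

import Mathlib

open MeasureTheory Filter Topology
open scoped Matrix Kronecker

namespace LTINetwork

noncomputable section

/-! ### Deterministic data of the network -/

/-- The nodal transfer function `h(s) = cᵀ (s I - A)⁻¹ b`. -/
def transferFunction {n : ℕ} (A : Matrix (Fin n) (Fin n) ℝ) (b c : Fin n → ℝ) (s : ℂ) : ℂ :=
  (fun a => (c a : ℂ)) ⬝ᵥ
    ((s • (1 : Matrix (Fin n) (Fin n) ℂ) - A.map Complex.ofReal)⁻¹ *ᵥ fun a => (b a : ℂ))

/-- The network state matrix `I_N ⊗ A + G ⊗ (b cᵀ)`. -/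
def stateMatrix {N n : ℕ} (A : Matrix (Fin n) (Fin n) ℝ) (b c : Fin n → ℝ)
    (G : Matrix (Fin N) (Fin N) ℝ) : Matrix (Fin N × Fin n) (Fin N × Fin n) ℝ :=
  (1 : Matrix (Fin N) (Fin N) ℝ) ⊗ₖ A + G ⊗ₖ Matrix.vecMulVec b c

/-- A real square matrix is Hurwitz if all its complex eigenvalues have negative real part. -/
def IsHurwitz {m : Type*} [Fintype m] [DecidableEq m] (M : Matrix m m ℝ) : Prop :=
  ∀ μ ∈ spectrum ℂ (M.map Complex.ofReal), μ.re < 0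

/-! ### Correlations and power spectral densities -/

section Correlation

variable {S : Type*} [MeasurableSpace S]

/-- `R` is the cross-correlation function of the processes `X` and `Y`:
`E(X(t) Y(t - τ)) = R(τ)`, whatever the time `t`. -/
def IsCrossCorrelation (P : Measure S) (X Y : ℝ → S → ℝ) (R : ℝ → ℝ) : Prop :=
  ∀ t τ : ℝ, ∫ s, X t s * Y (t - τ) s ∂P = R τ

/-- The process `X`, with values in `L²`, is differentiable in mean square at time `t`, and its
derivative there is the random variable `V`. -/
def HasMeanSquareDerivAt (P : Measure S) (X : ℝ → S → ℝ) (V : S → ℝ) (t : ℝ) : Prop :=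
  Tendsto (fun δ : ℝ => ∫ s, ((X (t + δ) s - X t s) / δ - V s) ^ 2 ∂P) (𝓝[≠] 0) (𝓝 0)

end Correlation

/-- The (cross-)power spectral density: the Fourier transform of a (cross-)correlation function,
in angular frequency. -/
def cpsd (R : ℝ → ℝ) (ω : ℝ) : ℂ :=
  ∫ τ : ℝ, (R τ : ℂ) * Complex.exp (-(Complex.I * ω * τ))

/-- The power spectral density that belongs to an autocorrelation function, as a real number.
Autocorrelation functions are even, so nothing is lost by taking the real part: see
`cpsd_eq_psd`. -/
def psd (R : ℝ → ℝ) (ω : ℝ) : ℝ := (cpsd R ω).re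

theorem cpsd_eq_psd (R : ℝ → ℝ) (hR : ∀ τ, R (-τ) = R τ) (ω : ℝ) : cpsd R ω = (psd R ω : ℂ) := by
  have h : (starRingEnd ℂ) (cpsd R ω) = cpsd R ω := by
    unfold cpsd
    rw [← integral_conj, ← integral_neg_eq_self]
    refine integral_congr_ae (Eventually.of_forall fun τ => ?_)
    simp [← Complex.exp_conj, hR]
  exact (Complex.conj_eq_iff_re.mp h).symm

/-- The matrix of cross-power spectral densities. -/
def cpsdMatrix {N : ℕ} (R : Fin N → Fin N → ℝ → ℝ) (ω : ℝ) : Matrix (Fin N) (Fin N) ℂ :=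
  Matrix.of fun i j => cpsd (R i j) ω

/-! ### The input noise -/

/-- The processes `w i` are uncorrelated zero-mean wide-sense stationary processes with the common
autocorrelation function `Rw`. -/
structure IsNoise {N : ℕ} {S : Type*} [MeasurableSpace S] (P : Measure S)
    (w : Fin N → ℝ → S → ℝ) (Rw : ℝ → ℝ) : Prop where
  memLp : ∀ i t, MemLp (w i t) 2 P
  mean_zero : ∀ i t, ∫ s, w i t s ∂P = 0
  autocorrelation : ∀ i, IsCrossCorrelation P (w i) (w i) Rw
  uncorrelated : ∀ i j, i ≠ j → ∀ t t', ∫ s, w i t s * w j t' s ∂P = 0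

/-- `(-Ω, Ω)` is an excitation frequency interval of a noise with autocorrelation `Rw`: its power
spectral density exists (`Rw` is integrable) and is positive on this nonempty interval. -/
structure IsExcitationInterval (Rw : ℝ → ℝ) (Ω : ℝ) : Prop where
  integrable : Integrable Rw
  pos : 0 < Ω
  psd_pos : ∀ ω ∈ Set.Ioo (-Ω) Ω, 0 < psd Rw ω

/-! ### The network dynamics -/

/-- The output processes `y_i = cᵀ x_i`. -/
def output {N n : ℕ} {S : Type*} (c : Fin n → ℝ) (x : Fin N → Fin n → ℝ → S → ℝ) :
    Fin N → ℝ → S → ℝ :=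
  fun i t s => ∑ a, c a * x i a t s

/-- `x i a` is the `a`-th component of the state of node `i`. These second-order processes on the
whole time axis solve, in mean square,
`ẋ_i = A x_i + b (∑_j g_ij y_j + w_i)`, where `y_i = cᵀ x_i`. -/
structure IsSolution {N n : ℕ} {S : Type*} [MeasurableSpace S] (P : Measure S)
    (A : Matrix (Fin n) (Fin n) ℝ) (b c : Fin n → ℝ) (G : Matrix (Fin N) (Fin N) ℝ)
    (w : Fin N → ℝ → S → ℝ) (x : Fin N → Fin n → ℝ → S → ℝ) : Prop where
  memLp : ∀ i a t, MemLp (x i a t) 2 P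
  hasDeriv : ∀ i a t, HasMeanSquareDerivAt P (x i a)
    (fun s => (∑ a', A a a' * x i a' t s) +
      b a * ((∑ j, G i j * output c x j t s) + w i t s)) t

end

end LTINetwork

namespace LTINetwork

noncomputable section

/-! ### Matrix exponentials of Hurwitz matrices -/

section MatrixExponential

open NormedSpace (exp)

attribute [local instance] Matrix.linftyOpNormedRing Matrix.linftyOpNormedAlgebra

variable {m : Type*} [Fintype m] [DecidableEq m]

/-! In the frequency domain the outputs are `K w` with `K = T⁻¹` and `T = h⁻¹ I - G`, so `S = S_w K
Kᴴ` and `S⁻¹ = S_w⁻¹ Tᴴ T`. Expanding, `Tᴴ T = |h⁻¹|² I - conj(h⁻¹) G - h⁻¹ Gᵀ + Gᵀ G`; the first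
and last terms are real, and the imaginary part is `Im(h⁻¹) (G - Gᵀ)`. Since `Tr(G²)` is a sum of
nonnegative terms `g_ij g_ji`, one of `g_ij`, `g_ji` always vanishes, and `g_ij` is the positive
part of `g_ij - g_ji`. The algebra rests on `transferMatrix_mul`, `inv_smul_mul_conjTranspose` and
`im_conjTranspose_mul_self_apply`.

The analytic work is to justify `S = S_w K Kᴴ` (`IsSolution.cpsdMatrix_eq`) when only the outputs,
not the states, are known to be in steady state. The processes are curves in the Hilbert space
`L²(P)`, and variation of constants from the infinite past writes an output as a transient `C
exp(tM) Z` plus the noise convolved with the impulse response. The output has constant norm and the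
convolution is bounded, so the transient is bounded on the whole time axis; for Hurwitz `M` it must
vanish (`sum_flow_smul_eq_zero`). The correlations are then iterated convolutions of integrable
functions, and the convolution theorem applies. -/

theorem map_ofReal_exp (M : Matrix m m ℝ) :
    (exp M).map Complex.ofReal = exp (M.map Complex.ofReal) := by
  have hc : Continuous (Complex.ofRealHom.mapMatrix : Matrix m m ℝ →+* Matrix m m ℂ) :=
    Continuous.matrix_map continuous_id Complex.continuous_ofReal
  exact NormedSpace.map_exp (Complex.ofRealHom.mapMatrix : Matrix m m ℝ →+* Matrix m m ℂ) hc M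

theorem exp_mulVec_eigenvector (A : Matrix m m ℂ) (v : m → ℂ) (ν : ℂ) (h : A *ᵥ v = ν • v) :
    exp A *ᵥ v = Complex.exp ν • v := by
  have hpow : ∀ k : ℕ, A ^ k *ᵥ v = ν ^ k • v := by
    intro k
    induction k with
    | zero => simp
    | succ k ih =>
      rw [pow_succ, ← Matrix.mulVec_mulVec, h, Matrix.mulVec_smul, ih, smul_smul, pow_succ,
        mul_comm]
  have hs := NormedSpace.exp_series_hasSum_exp' (𝕂 := ℂ) A
  have hc : Continuous fun B : Matrix m m ℂ => B *ᵥ v :=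
    Continuous.matrix_mulVec continuous_id continuous_const
  have h1 := hs.map (AddMonoidHom.mk' (fun B : Matrix m m ℂ => B *ᵥ v)
    fun B C => Matrix.add_mulVec B C v) hc
  have h2 := (NormedSpace.exp_series_hasSum_exp' (𝕂 := ℂ) ν).smul_const v
  rw [← Complex.exp_eq_exp_ℂ] at h2
  refine h1.unique ?_
  convert h2 using 1
  ext k : 1
  simp [Matrix.smul_mulVec, hpow, smul_smul]

/-- Half of the spectral mapping theorem: an eigenspace of `exp A` is invariant under `A`, which
commutes with it, so it contains an eigenvector of `A`. If `ν` is its eigenvalue, then `μ = e^ν`. -/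
theorem norm_lt_one_of_mem_spectrum_exp {M : Matrix m m ℝ} (hM : IsHurwitz M) {μ : ℂ}
    (hμ : μ ∈ spectrum ℂ ((exp M).map Complex.ofReal)) : ‖μ‖ < 1 := by
  rw [map_ofReal_exp] at hμ
  set A := M.map Complex.ofReal with hA
  set f : Module.End ℂ (m → ℂ) := Matrix.toLin' (exp A)
  set g : Module.End ℂ (m → ℂ) := Matrix.toLin' A
  have hf : f.HasEigenvalue μ := by
    rw [Module.End.hasEigenvalue_iff_mem_spectrum, Matrix.spectrum_toLin']
    exact hμ
  have hcomm : Commute f g := by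
    have : Commute (exp A) A := (Commute.refl A).exp_left
    change f * g = g * f
    simp only [f, g, Module.End.mul_eq_comp, ← Matrix.toLin'_mul]
    rw [this.eq]
  have hmaps := Module.End.mapsTo_genEigenspace_of_comm hcomm μ 1
  have hnt : Nontrivial (f.eigenspace μ) := Submodule.nontrivial_iff_ne_bot.mpr hf
  obtain ⟨ν, hν⟩ := Module.End.exists_eigenvalue (g.restrict hmaps)
  obtain ⟨v, hv⟩ := hν.exists_hasEigenvector
  have hv1 : g v = ν • (v : m → ℂ) := congrArg Subtype.val hv.apply_eq_smul
  have hv0 : (v : m → ℂ) ≠ 0 := fun h => hv.2 (Subtype.ext h)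
  have hgν : ν ∈ spectrum ℂ A := by
    rw [← Matrix.spectrum_toLin', ← Module.End.hasEigenvalue_iff_mem_spectrum]
    exact Module.End.hasEigenvalue_of_hasEigenvector
      ⟨Module.End.mem_eigenspace_iff.mpr hv1, hv0⟩
  have hfv : f v = μ • (v : m → ℂ) := Module.End.mem_eigenspace_iff.mp v.2
  have hev : f v = Complex.exp ν • (v : m → ℂ) := by
    simp only [f, Matrix.toLin'_apply]
    exact exp_mulVec_eigenvector A v ν (by simpa [g, Matrix.toLin'_apply] using hv1)
  have : μ = Complex.exp ν := smul_left_injective ℂ hv0 (hfv.symm.trans hev)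
  rw [this, Complex.norm_exp, Real.exp_lt_one_iff]
  exact hM ν hgν

theorem exp_add_smul (M : Matrix m m ℝ) (s t : ℝ) :
    exp ((s + t) • M) = exp (s • M) * exp (t • M) := by
  rw [add_smul]
  exact Matrix.exp_add_of_commute _ _ (((Commute.refl M).smul_left s).smul_right t)

theorem exp_nat_smul (M : Matrix m m ℝ) (k : ℕ) : exp ((k : ℝ) • M) = exp M ^ k := by
  rw [Nat.cast_smul_eq_nsmul ℝ k M, Matrix.exp_nsmul]

theorem hasDerivAt_exp_smul_apply (M : Matrix m m ℝ) (t : ℝ) (p q : m) :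
    HasDerivAt (fun u : ℝ => exp (u • M) p q) ((M * exp (t • M)) p q) t := by
  have h := hasDerivAt_exp_smul_const' (𝕂 := ℝ) M t
  have h' := (Matrix.entryLinearMap ℝ ℝ p q).toContinuousLinearMap.hasFDerivAt.comp_hasDerivAt t h
  exact h'

theorem continuous_exp_smul_apply (M : Matrix m m ℝ) (p q : m) :
    Continuous fun u : ℝ => exp (u • M) p q :=
  continuous_iff_continuousAt.mpr fun t => (hasDerivAt_exp_smul_apply M t p q).continuousAt

/-- The spectral radius of `exp M` is below 1, so by Gelfand's formula its powers decay
geometrically. Compactness of `[0, 1]` handles the fractional part of `t`. -/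
theorem exists_abs_exp_smul_le {M : Matrix m m ℝ} (hM : IsHurwitz M) :
    ∃ K a : ℝ, 0 < a ∧ ∀ t : ℝ, 0 ≤ t → ∀ p q, |exp (t • M) p q| ≤ K * Real.exp (-a * t) := by
  cases isEmpty_or_nonempty m
  · exact ⟨0, 1, one_pos, fun t _ p => isEmptyElim p⟩
  have hnorm : ∀ B : Matrix m m ℝ, ‖B.map Complex.ofReal‖ = ‖B‖ := fun B => by
    have : ‖B.map Complex.ofReal‖₊ = ‖B‖₊ :=
      by simp [Matrix.linfty_opNNNorm_def]
    exact congrArg NNReal.toReal this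
  set D := (exp M).map Complex.ofReal with hD
  have hDpow : ∀ k : ℕ, ‖D ^ k‖ = ‖exp M ^ k‖ := fun k => by
    rw [← hnorm (exp M ^ k)]
    congr 1
    exact (map_pow (Complex.ofRealHom.mapMatrix : Matrix m m ℝ →+* Matrix m m ℂ) (exp M) k).symm
  have hrad : spectralRadius ℂ D < (1 : NNReal) :=
    spectrum.spectralRadius_lt_of_forall_lt D fun z hz => by
      rw [← NNReal.coe_lt_coe]
      exact norm_lt_one_of_mem_spectrum_exp hM hz
  obtain ⟨r, hr1, hr2⟩ := ENNReal.lt_iff_exists_nnreal_btwn.mp hrad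
  have hr2' : r < 1 := by exact_mod_cast hr2
  have hr0 : 0 < r := by
    rcases eq_or_lt_of_le (zero_le : 0 ≤ r) with h | h
    · simp [← h] at hr1
    · exact h
  have hev := (spectrum.pow_nnnorm_pow_one_div_tendsto_nhds_spectralRadius D).eventually_lt_const
    hr1
  obtain ⟨k₀, hk₀⟩ := eventually_atTop.mp hev
  have hbig : ∀ k, max k₀ 1 ≤ k → ‖exp M ^ k‖ ≤ (r : ℝ) ^ k := by
    intro k hk
    have h1 := (hk₀ k (le_of_max_le_left hk)).le
    have hk1 : 1 ≤ k := le_of_max_le_right hk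
    have hk0 : (k : ℝ) ≠ 0 := by positivity
    have h2 := ENNReal.rpow_le_rpow h1 (Nat.cast_nonneg k)
    rw [← ENNReal.rpow_mul, one_div, inv_mul_cancel₀ hk0, ENNReal.rpow_one,
      ENNReal.rpow_natCast] at h2
    rw [← hDpow]
    exact_mod_cast h2
  obtain ⟨K₁, hK₁⟩ : ∃ K₁ : ℝ, ∀ k < max k₀ 1, ‖exp M ^ k‖ ≤ K₁ := by
    obtain ⟨K₁, h⟩ := ((Set.finite_Iio (max k₀ 1)).image fun k => ‖exp M ^ k‖).bddAbove
    exact ⟨K₁, fun k hk => h ⟨k, hk, rfl⟩⟩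
  obtain ⟨K₂, hK₂⟩ : ∃ K₂ : ℝ, ∀ s ∈ Set.Icc (0 : ℝ) 1, ‖exp (s • M)‖ ≤ K₂ :=
    isCompact_Icc.exists_bound_of_continuousOn
      (NormedSpace.exp_continuous.comp (continuous_id.smul continuous_const)).continuousOn
  have hr0' : (0 : ℝ) < r := hr0
  have hr1' : (r : ℝ) < 1 := hr2'
  have hK2 : 0 ≤ K₂ := (norm_nonneg _).trans (hK₂ 0 (by simp))
  -- The 1 serves the exponents where Gelfand's bound holds, the quotient the finitely many earlier
  -- ones.
  set K₃ := max 1 (|K₁| / (r : ℝ) ^ (max k₀ 1)) with hK3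
  have hK3p : 0 < K₃ := lt_of_lt_of_le one_pos (le_max_left _ _)
  have hall : ∀ k, ‖exp M ^ k‖ ≤ K₃ * (r : ℝ) ^ k := by
    intro k
    rcases le_or_gt (max k₀ 1) k with hk | hk
    · exact (hbig k hk).trans (le_mul_of_one_le_left (by positivity) (le_max_left _ _))
    · calc ‖exp M ^ k‖ ≤ |K₁| := (hK₁ k hk).trans (le_abs_self _)
        _ = |K₁| / (r : ℝ) ^ (max k₀ 1) * (r : ℝ) ^ (max k₀ 1) := by field_simp
        _ ≤ K₃ * (r : ℝ) ^ k :=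
          mul_le_mul (le_max_right _ _) (pow_le_pow_of_le_one hr0'.le hr1'.le hk.le)
            (by positivity) hK3p.le
  refine ⟨K₃ * K₂ / r, -Real.log r, neg_pos.mpr (Real.log_neg hr0' hr1'), fun t ht p q => ?_⟩
  have hfl := Nat.floor_le ht
  have hlt := Nat.lt_floor_add_one t
  have hdec : exp (t • M) = exp M ^ ⌊t⌋₊ * exp ((t - ⌊t⌋₊) • M) := by
    rw [← exp_nat_smul, ← exp_add_smul]; congr 2; ring
  have hentry : |exp (t • M) p q| ≤ ‖exp (t • M)‖ := by
    rw [Matrix.linfty_opNorm_def, ← Real.norm_eq_abs, ← coe_nnnorm, NNReal.coe_le_coe]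
    refine le_trans ?_ (Finset.le_sup (Finset.mem_univ p))
    exact Finset.single_le_sum (f := fun j => ‖exp (t • M) p j‖₊) (fun _ _ => zero_le)
      (Finset.mem_univ q)
  -- Replacing `⌊t⌋` by `t < ⌊t⌋ + 1` costs one factor `r`.
  have hpw : (r : ℝ) ^ ⌊t⌋₊ ≤ Real.exp (Real.log r * t) / r := by
    rw [le_div_iff₀ hr0', ← pow_succ, ← Real.rpow_def_of_pos hr0',
      ← Real.rpow_natCast]
    refine Real.rpow_le_rpow_of_exponent_ge hr0' hr1'.le ?_
    push_cast
    exact hlt.le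
  calc |exp (t • M) p q| ≤ ‖exp M ^ ⌊t⌋₊‖ * ‖exp ((t - ⌊t⌋₊) • M)‖ :=
        hentry.trans (hdec ▸ norm_mul_le _ _)
    _ ≤ (K₃ * (r : ℝ) ^ ⌊t⌋₊) * K₂ :=
        mul_le_mul (hall _) (hK₂ _ ⟨by linarith, by linarith⟩) (norm_nonneg _) (by positivity)
    _ ≤ (K₃ * (Real.exp (Real.log r * t) / r)) * K₂ := by gcongr
    _ = K₃ * K₂ / r * Real.exp (- -Real.log r * t) := by rw [neg_neg]; ring

/-- The flow `exp (t M)` of the linear system `ẋ = M x`. -/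
def flow (M : Matrix m m ℝ) (t : ℝ) : Matrix m m ℝ := exp (t • M)

theorem flow_zero (M : Matrix m m ℝ) : flow M 0 = 1 := by simp [flow]

theorem flow_add (M : Matrix m m ℝ) (s t : ℝ) : flow M (s + t) = flow M s * flow M t :=
  exp_add_smul M s t

theorem commute_flow (M : Matrix m m ℝ) (t : ℝ) : Commute M (flow M t) :=
  ((Commute.refl M).smul_right t).exp_right

theorem hasDerivAt_flow_apply (M : Matrix m m ℝ) (t : ℝ) (p q : m) :
    HasDerivAt (fun u : ℝ => flow M u p q) ((M * flow M t) p q) t :=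
  hasDerivAt_exp_smul_apply M t p q

theorem continuous_flow_apply (M : Matrix m m ℝ) (p q : m) :
    Continuous fun u : ℝ => flow M u p q :=
  continuous_exp_smul_apply M p q

theorem exists_abs_flow_le {M : Matrix m m ℝ} (hM : IsHurwitz M) :
    ∃ K a : ℝ, 0 < a ∧ ∀ t : ℝ, 0 ≤ t → ∀ p q, |flow M t p q| ≤ K * Real.exp (-a * t) :=
  exists_abs_exp_smul_le hM

theorem norm_lt_one_of_mem_spectrum_flow {M : Matrix m m ℝ} (hM : IsHurwitz M) {μ : ℂ}
    (hμ : μ ∈ spectrum ℂ ((flow M 1).map Complex.ofReal)) : ‖μ‖ < 1 := by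
  rw [flow, one_smul] at hμ
  exact norm_lt_one_of_mem_spectrum_exp hM hμ

end MatrixExponential

/-! ### Bounded orbits on the whole time axis -/

section BoundedOrbits

open Polynomial

/-- The left shift on two-sided sequences. -/
def shift : Module.End ℂ (ℤ → ℂ) := LinearMap.funLeft ℂ ℂ fun k : ℤ => k + 1

theorem shift_apply (φ : ℤ → ℂ) (k : ℤ) : shift φ k = φ (k + 1) := rfl

theorem eq_zero_of_bounded_of_geometric {μ : ℂ} (hμ : ‖μ‖ < 1) {φ : ℤ → ℂ} {K : ℝ}
    (hK : ∀ k, ‖φ k‖ ≤ K) (h : ∀ k, φ (k + 1) = μ * φ k) : φ = 0 := by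
  -- Only boundedness in the past matters: `φ k` is traced back to ever earlier times.
  have hiter : ∀ (j : ℕ) (k : ℤ), φ k = μ ^ j * φ (k - j) := by
    intro j
    induction j with
    | zero => intro k; simp
    | succ j ih =>
      intro k
      rw [ih k, pow_succ, mul_assoc, ← h]
      congr 2
      push_cast
      ring
  funext k
  have hlim : Tendsto (fun j : ℕ => ‖μ‖ ^ j * K) atTop (𝓝 (0 * K)) :=
    (tendsto_pow_atTop_nhds_zero_of_lt_one (norm_nonneg μ) hμ).mul_const K
  rw [zero_mul] at hlim
  have : ‖φ k‖ ≤ 0 := ge_of_tendsto' hlim fun j => by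
    rw [hiter j k, norm_mul, norm_pow]
    exact mul_le_mul_of_nonneg_left (hK _) (by positivity)
  simpa using this

theorem eq_zero_of_bounded_of_prod_X_sub_C (s : Multiset ℂ) (hs : ∀ μ ∈ s, ‖μ‖ < 1) :
    ∀ (φ : ℤ → ℂ) (K : ℝ), (∀ k, ‖φ k‖ ≤ K) →
      aeval shift (s.map fun μ => X - C μ).prod φ = 0 → φ = 0 := by
  induction s using Multiset.induction_on with
  | empty => intro φ K _ h; simpa using h
  | cons μ s ih =>
    intro φ K hK h
    rw [Multiset.map_cons, Multiset.prod_cons, mul_comm, map_mul, Module.End.mul_apply] at h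
    have hψ : ∀ k, aeval shift (X - C μ) φ k = φ (k + 1) - μ * φ k := fun k => by
      simp [shift_apply, Module.algebraMap_end_apply]
    -- The sequence `(shift - μ) φ` is again bounded and is annihilated by the remaining factors, so
    -- it vanishes; `φ` is then geometric with ratio `μ`.
    have h0 := ih (fun ν hν => hs ν (Multiset.mem_cons_of_mem hν)) _ (K + ‖μ‖ * K)
      (fun k => by
        rw [hψ]
        refine (norm_sub_le _ _).trans (add_le_add (hK _) ?_)
        rw [norm_mul]
        exact mul_le_mul_of_nonneg_left (hK _) (norm_nonneg _)) h
    refine eq_zero_of_bounded_of_geometric (hs μ (Multiset.mem_cons_self _ _)) hK fun k => ?_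
    have := congrFun h0 k
    rw [hψ] at this
    exact sub_eq_zero.mp this

variable {m : Type*} [Fintype m] [DecidableEq m]

theorem aeval_shift_apply (E : Matrix m m ℂ) (F : ℤ → Matrix m m ℂ) (hF : ∀ k, F (k + 1) = E * F k)
    (v u : m → ℂ) (p : ℂ[X]) (k : ℤ) :
    aeval shift p (fun k => v ⬝ᵥ (F k *ᵥ u)) k = v ⬝ᵥ ((aeval E p * F k) *ᵥ u) := by
  have hpow : ∀ (j : ℕ) (φ : ℤ → ℂ) (k : ℤ), (shift ^ j) φ k = φ (k + j) := by
    intro j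
    induction j with
    | zero => intro φ k; simp
    | succ j ih =>
      intro φ k
      rw [pow_succ, Module.End.mul_apply, ih, shift_apply]
      congr 1
      push_cast
      ring
  have hF' : ∀ (j : ℕ) (k : ℤ), F (k + j) = E ^ j * F k := by
    intro j
    induction j with
    | zero => intro k; simp
    | succ j ih =>
      intro k
      rw [pow_succ', mul_assoc, ← ih, ← hF]
      congr 1
      push_cast
      ring
  induction p using Polynomial.induction_on' with
  | add p q hp hq =>
    simp only [map_add, LinearMap.add_apply, Pi.add_apply, hp, hq, add_mul, Matrix.add_mulVec,
      dotProduct_add]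
  | monomial j a =>
    simp only [aeval_monomial, Algebra.algebraMap_eq_smul_one, smul_mul_assoc, one_mul,
      Matrix.smul_mulVec, dotProduct_smul]
    rw [← hF', LinearMap.smul_apply, Pi.smul_apply, hpow]

/-- A function `t ↦ vᵀ exp (t M) u` with `M` Hurwitz that is bounded on the whole time axis
vanishes. -/
theorem dotProduct_flow_mulVec_eq_zero {M : Matrix m m ℝ} (hM : IsHurwitz M) (v u : m → ℝ)
    {K : ℝ} (hK : ∀ t, |v ⬝ᵥ (flow M t *ᵥ u)| ≤ K) (t : ℝ) : v ⬝ᵥ (flow M t *ᵥ u) = 0 := by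
  -- Sampling at the times `t + k` gives a two-sided sequence. By Cayley–Hamilton the characteristic
  -- polynomial of `E`, taken in the shift, annihilates it, and all its roots lie in the open unit
  -- disc.
  set E : Matrix m m ℂ := (flow M 1).map Complex.ofReal with hE
  set F : ℤ → Matrix m m ℂ := fun k => (flow M (t + k)).map Complex.ofReal with hF
  set v' : m → ℂ := fun p => (v p : ℂ)
  set u' : m → ℂ := fun p => (u p : ℂ)
  have hstep : ∀ k, F (k + 1) = E * F k := fun k => by
    have h1 : flow M (t + ((k + 1 : ℤ) : ℝ)) = flow M 1 * flow M (t + k) := by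
      rw [← flow_add]; congr 1; push_cast; ring
    simp only [hF, hE, h1]
    exact map_mul (Complex.ofRealHom.mapMatrix : Matrix m m ℝ →+* Matrix m m ℂ) _ _
  have hφ : ∀ k, v' ⬝ᵥ (F k *ᵥ u') = ((v ⬝ᵥ (flow M (t + k) *ᵥ u) : ℝ) : ℂ) := fun k => by
    simp [dotProduct, Matrix.mulVec, v', u', hF]
  have hroots : (E.charpoly.roots.map fun μ => X - C μ).prod = E.charpoly :=
    prod_multiset_X_sub_C_of_monic_of_roots_card_eq E.charpoly_monic
      (IsAlgClosed.card_roots_eq_natDegree)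
  have hzero := eq_zero_of_bounded_of_prod_X_sub_C E.charpoly.roots
    (fun μ hμ => norm_lt_one_of_mem_spectrum_flow hM
      (Matrix.mem_spectrum_of_isRoot_charpoly (isRoot_of_mem_roots hμ)))
    (fun k => v' ⬝ᵥ (F k *ᵥ u')) K
    (fun k => by rw [hφ, Complex.norm_real]; exact hK _)
    (by
      rw [hroots]
      funext k
      rw [aeval_shift_apply E F hstep, Matrix.aeval_self_charpoly]
      simp)
  have h0 := congrFun hzero 0
  simp only [hφ] at h0
  simpa using h0

/-- Pairing with an arbitrary `ξ` reduces to the scalar case. -/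
theorem sum_flow_smul_eq_zero {H : Type*} [NormedAddCommGroup H] [InnerProductSpace ℝ H]
    {M : Matrix m m ℝ} (hM : IsHurwitz M) (v : m → ℝ) (z : m → H) {K : ℝ}
    (hK : ∀ t, ‖∑ p, v p • ∑ q, flow M t p q • z q‖ ≤ K) (t : ℝ) :
    ∑ p, v p • ∑ q, flow M t p q • z q = 0 := by
  refine ext_inner_left ℝ fun ξ => ?_
  have key : ∀ t, v ⬝ᵥ (flow M t *ᵥ fun q => inner ℝ ξ (z q)) =
      inner ℝ ξ (∑ p, v p • ∑ q, flow M t p q • z q) := fun t => by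
    simp [dotProduct, Matrix.mulVec, inner_sum, inner_smul_right]
  rw [inner_zero_right, ← key]
  refine dotProduct_flow_mulVec_eq_zero hM v _ (K := ‖ξ‖ * K) (fun t => ?_) t
  rw [key]
  exact (abs_real_inner_le_norm _ _).trans (mul_le_mul_of_nonneg_left (hK t) (norm_nonneg _))

end BoundedOrbits

/-! ### Variation of constants and the steady state -/

section SteadyState

variable {m : Type*} [Fintype m] [DecidableEq m]

theorem integrableOn_flow_apply {M : Matrix m m ℝ} (hM : IsHurwitz M) (p q : m) :
    IntegrableOn (fun u => flow M u p q) (Set.Ici 0) := by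
  obtain ⟨K, a, ha, h⟩ := exists_abs_flow_le hM
  rw [integrableOn_Ici_iff_integrableOn_Ioi]
  refine ((integrableOn_exp_mul_Ioi (neg_neg_of_pos ha) 0).const_mul K).mono'
    (continuous_flow_apply M p q).aestronglyMeasurable ?_
  filter_upwards [ae_restrict_mem measurableSet_Ioi] with u hu
  exact h u (le_of_lt hu) p q

theorem integrableOn_flow_sub_apply {M : Matrix m m ℝ} (hM : IsHurwitz M) (t : ℝ) (p q : m) :
    IntegrableOn (fun u => flow M (t - u) p q) (Set.Iic t) := by
  have h := integrableOn_flow_apply hM p q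
  rw [← integrable_indicator_iff measurableSet_Ici] at h
  rw [← integrable_indicator_iff measurableSet_Iic]
  refine (h.comp_sub_left t).congr (Eventually.of_forall fun u => ?_)
  by_cases hu : u ≤ t <;> simp [Set.indicator, hu]

theorem integrableOn_flow_neg_apply {M : Matrix m m ℝ} (hM : IsHurwitz M) (t : ℝ) (p q : m) :
    IntegrableOn (fun u => flow M (-u) p q) (Set.Iic t) := by
  have h : ∀ u, flow M (-u) p q = ∑ r, flow M (-t) p r * flow M (t - u) r q := fun u => by
    rw [← Matrix.mul_apply, ← flow_add]
    congr 2
    ring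
  simp only [h]
  exact integrable_finsetSum _ fun r _ => (integrableOn_flow_sub_apply hM t r q).const_mul _

variable {H : Type*} [NormedAddCommGroup H] [NormedSpace ℝ H]

theorem integrable_smul_of_bounded {α : Type*} [MeasurableSpace α] {μ : Measure α} {f : α → ℝ}
    (hf : Integrable f μ) {g : α → H} (hg : AEStronglyMeasurable g μ) {K : ℝ}
    (hK : ∀ u, ‖g u‖ ≤ K) : Integrable (fun u => f u • g u) μ :=
  (hf.norm.mul_const K).mono' (hf.aestronglyMeasurable.smul hg) <| Eventually.of_forall fun u => by
    rw [norm_smul]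
    exact mul_le_mul_of_nonneg_left (hK u) (norm_nonneg _)

/-- The impulse response of the system `ẋ = M x + B u`, `y = C x`. -/
def impulseResponse {k l : Type*} (M : Matrix m m ℝ) (B : Matrix m l ℝ) (C : Matrix k m ℝ)
    (i : k) (j : l) : ℝ → ℝ :=
  (Set.Ici 0).indicator fun u => (C * flow M u * B) i j

theorem integrable_impulseResponse {k l : Type*} {M : Matrix m m ℝ} (hM : IsHurwitz M)
    (B : Matrix m l ℝ) (C : Matrix k m ℝ) (i : k) (j : l) :
    Integrable (impulseResponse M B C i j) := by
  rw [impulseResponse, integrable_indicator_iff measurableSet_Ici]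
  simp only [Matrix.mul_apply]
  exact integrable_finsetSum _ fun q _ => (integrable_finsetSum _ fun p _ =>
    (integrableOn_flow_apply hM p q).const_mul _).mul_const _

/-- The integrating factor: `M` commutes with its flow, so the two terms in `M X` cancel. -/
theorem hasDerivAt_flow_neg_smul (M : Matrix m m ℝ) {X U : m → ℝ → H}
    (hX : ∀ p t, HasDerivAt (X p) (∑ q, M p q • X q t + U p t) t) (p : m) (t : ℝ) :
    HasDerivAt (fun t => ∑ q, flow M (-t) p q • X q t) (∑ q, flow M (-t) p q • U q t) t := by
  have h1 : ∀ q, HasDerivAt (fun t => flow M (-t) p q) (-((flow M (-t) * M) p q)) t := fun q => by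
    have h := (hasDerivAt_flow_apply M (-t) p q).scomp t (hasDerivAt_neg t)
    rw [(commute_flow M (-t)).eq] at h
    simpa [Function.comp_def] using h
  have h2 := HasDerivAt.fun_sum (u := Finset.univ) fun q _ => (h1 q).smul (hX q t)
  refine h2.congr_deriv ?_
  simp only [smul_add, Finset.sum_add_distrib, neg_smul, Finset.sum_neg_distrib,
    Matrix.mul_apply, Finset.sum_smul, Finset.smul_sum, smul_smul]
  rw [Finset.sum_comm (f := fun q r => (flow M (-t) p q * M q r) • X r t)]
  abel

/-- Variation of constants, from the infinite past. -/
theorem exists_eq_flow_smul_add_integral [CompleteSpace H] {M : Matrix m m ℝ} (hM : IsHurwitz M) {X U : m → ℝ → H}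
    (hX : ∀ p t, HasDerivAt (X p) (∑ q, M p q • X q t + U p t) t)
    (hU : ∀ q, AEStronglyMeasurable (U q)) {K : ℝ} (hK : ∀ q t, ‖U q t‖ ≤ K) :
    ∃ Z : m → H, ∀ p t, X p t = (∑ q, flow M t p q • Z q) +
      ∫ u in Set.Iic t, ∑ q, flow M (t - u) p q • U q u := by
  set g : m → ℝ → H := fun p u => ∑ q, flow M (-u) p q • U q u with hg
  have hgint : ∀ p t, IntegrableOn (g p) (Set.Iic t) := fun p t =>
    integrable_finsetSum _ fun q _ =>
      integrable_smul_of_bounded (integrableOn_flow_neg_apply hM t p q) (hU q).restrict (hK q)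
  set Ξ : m → ℝ → H := fun p t => ∑ q, flow M (-t) p q • X q t with hΞ
  set I : m → ℝ → H := fun p t => ∫ u in Set.Iic t, g p u with hI
  have hconst : ∀ p t, Ξ p t = (Ξ p 0 - I p 0) + I p t := fun p t => by
    have h1 : ∫ u in (0 : ℝ)..t, g p u = Ξ p t - Ξ p 0 :=
      intervalIntegral.integral_eq_sub_of_hasDerivAt
        (fun u _ => hasDerivAt_flow_neg_smul M hX p u)
        ⟨(hgint p t).mono_set Set.Ioc_subset_Iic_self,
          (hgint p 0).mono_set Set.Ioc_subset_Iic_self⟩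
    rw [← intervalIntegral.integral_Iic_sub_Iic (hgint p 0) (hgint p t)] at h1
    simp only [hI]
    rw [← sub_eq_zero] at h1 ⊢
    rw [← neg_eq_zero, ← h1]
    abel
  have hassemble : ∀ (t s : ℝ) (p : m) (V : m → H),
      ∑ q, flow M t p q • ∑ r, flow M s q r • V r = ∑ r, flow M (t + s) p r • V r := by
    intro t s p V
    simp only [flow_add, Matrix.mul_apply, Finset.sum_smul, Finset.smul_sum, smul_smul]
    exact Finset.sum_comm
  -- `Ξ - I` is constant in time. No boundedness of `X` is required; any growth in the past is
  -- carried by `Z`.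
  refine ⟨fun p => Ξ p 0 - I p 0, fun p t => ?_⟩
  have hX' : X p t = ∑ q, flow M t p q • Ξ q t := by
    rw [hassemble, add_neg_cancel, flow_zero]
    simp [Matrix.one_apply]
  have hI' : ∑ q, flow M t p q • I q t =
      ∫ u in Set.Iic t, ∑ q, flow M (t - u) p q • U q u := by
    simp only [hI, ← integral_smul]
    refine (integral_finsetSum _ fun q _ => (hgint q t).smul (flow M t p q)).symm.trans ?_
    simp only [hg, Pi.smul_apply, hassemble, ← sub_eq_add_neg]
  rw [hX', ← hI', ← Finset.sum_add_distrib]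
  exact Finset.sum_congr rfl fun q _ => by rw [← smul_add, ← hconst]

end SteadyState

theorem sum_mul_smul {k l m H : Type*} [Fintype m] [Fintype l] [AddCommGroup H] [Module ℝ H]
    (P : Matrix k m ℝ) (Q : Matrix m l ℝ) (V : l → H) (r : k) :
    ∑ j, (P * Q) r j • V j = ∑ s, P r s • ∑ j, Q s j • V j := by
  simp only [Matrix.mul_apply, Finset.sum_smul, Finset.smul_sum, smul_smul]
  exact Finset.sum_comm

section SteadyStateOutput

variable {m k l : Type*} [Fintype m] [DecidableEq m] [Fintype l]
  {H : Type*} [NormedAddCommGroup H] [InnerProductSpace ℝ H] [CompleteSpace H]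

/-- A bounded output of a linear system with Hurwitz state matrix and bounded input is the
convolution of the impulse response with the input. -/
theorem output_eq_integral_impulseResponse {M : Matrix m m ℝ} (hM : IsHurwitz M)
    (B : Matrix m l ℝ) (C : Matrix k m ℝ) {X : m → ℝ → H} {W : l → ℝ → H}
    (hX : ∀ p t, HasDerivAt (X p) (∑ q, M p q • X q t + ∑ j, B p j • W j t) t)
    (hW : ∀ j, AEStronglyMeasurable (W j)) {K : ℝ} (hK : ∀ j t, ‖W j t‖ ≤ K) (i : k) {L : ℝ}
    (hL : ∀ t, ‖∑ p, C i p • X p t‖ ≤ L) (t : ℝ) :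
    ∑ p, C i p • X p t = ∑ j, ∫ u, impulseResponse M B C i j (t - u) • W j u := by
  have hUm : ∀ q, AEStronglyMeasurable fun t => ∑ j, B q j • W j t := fun q =>
    Finset.aestronglyMeasurable_fun_sum _ fun j _ => (hW j).const_smul _
  have hUb : ∀ q t, ‖∑ j, B q j • W j t‖ ≤ ∑ q, ∑ j, |B q j| * |K| := fun q t => by
    refine (norm_sum_le _ _).trans (le_trans (Finset.sum_le_sum fun j _ => ?_)
      (Finset.single_le_sum (f := fun q => ∑ j, |B q j| * |K|)
        (fun _ _ => Finset.sum_nonneg fun _ _ => by positivity) (Finset.mem_univ q)))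
    rw [norm_smul, Real.norm_eq_abs]
    exact mul_le_mul_of_nonneg_left ((hK j t).trans (le_abs_self K)) (abs_nonneg _)
  obtain ⟨Z, hZ⟩ := exists_eq_flow_smul_add_integral hM hX hUm hUb
  have hflow : ∀ t p, IntegrableOn (fun u => ∑ q, flow M (t - u) p q • ∑ j, B q j • W j u)
      (Set.Iic t) := fun t p => integrable_finsetSum _ fun q _ =>
    integrable_smul_of_bounded (integrableOn_flow_sub_apply hM t p q) (hUm q).restrict (hUb q)
  have hint : ∀ t j, Integrable fun u => impulseResponse M B C i j (t - u) • W j u := fun t j =>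
    integrable_smul_of_bounded ((integrable_impulseResponse hM B C i j).comp_sub_left t) (hW j)
      (hK j)
  have hind : ∀ t u : ℝ, ∑ j, impulseResponse M B C i j (t - u) • W j u =
      (Set.Iic t).indicator (fun u => ∑ p, C i p • ∑ q, flow M (t - u) p q •
        ∑ j, B q j • W j u) u := by
    intro t u
    by_cases hu : u ≤ t
    · rw [Set.indicator_of_mem (Set.mem_Iic.mpr hu)]
      have hu' : t - u ∈ Set.Ici (0 : ℝ) := by simpa using hu
      have hl : ∀ j, impulseResponse M B C i j (t - u) = (C * (flow M (t - u) * B)) i j :=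
        fun j => by rw [impulseResponse, Set.indicator_of_mem hu', Matrix.mul_assoc]
      simp only [hl, sum_mul_smul]
    · rw [Set.indicator_of_notMem (by simpa using hu)]
      have hu' : t - u ∉ Set.Ici (0 : ℝ) := by simpa using hu
      simp [impulseResponse, Set.indicator_of_notMem hu']
  have hsteady : ∀ t, ∑ p, C i p • (∫ u in Set.Iic t, ∑ q, flow M (t - u) p q •
      ∑ j, B q j • W j u) = ∑ j, ∫ u, impulseResponse M B C i j (t - u) • W j u := by
    intro t
    rw [← integral_finsetSum _ fun j _ => hint t j]
    simp only [hind]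
    rw [integral_indicator measurableSet_Iic, integral_finsetSum]
    · simp only [integral_smul]
    · exact fun p _ => (hflow t p).smul (C i p)
  have hsplit : ∀ t, ∑ p, C i p • X p t = (∑ p, C i p • ∑ q, flow M t p q • Z q) +
      ∑ j, ∫ u, impulseResponse M B C i j (t - u) • W j u := fun t => by
    rw [← hsteady, ← Finset.sum_add_distrib]
    exact Finset.sum_congr rfl fun p _ => by rw [← smul_add, ← hZ]
  have hbound : ∀ t, ‖∑ j, ∫ u, impulseResponse M B C i j (t - u) • W j u‖ ≤
      ∑ j, (∫ u, ‖impulseResponse M B C i j u‖) * K := fun t => by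
    refine (norm_sum_le _ _).trans (Finset.sum_le_sum fun j _ => ?_)
    rw [← integral_sub_left_eq_self (fun u => ‖impulseResponse M B C i j u‖) volume t,
      ← integral_mul_const]
    refine norm_integral_le_of_norm_le
      (((integrable_impulseResponse hM B C i j).comp_sub_left t).norm.mul_const K)
      (Eventually.of_forall fun u => ?_)
    rw [norm_smul]
    exact mul_le_mul_of_nonneg_left (hK j u) (norm_nonneg _)
  -- The transient is the output minus the convolution, hence bounded on the whole axis.
  have hzero := sum_flow_smul_eq_zero hM (C i) Z
    (K := L + ∑ j, (∫ u, ‖impulseResponse M B C i j u‖) * K) (fun t => by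
      rw [← add_sub_cancel_right (∑ p, C i p • ∑ q, flow M t p q • Z q)
        (∑ j, ∫ u, impulseResponse M B C i j (t - u) • W j u), ← hsplit]
      exact (norm_sub_le _ _).trans (add_le_add (hL t) (hbound t))) t
  rw [hsplit, hzero, zero_add]

end SteadyStateOutput

/-! ### Correlations of filtered noise and their power spectral densities -/

section Spectra

open scoped Convolution FourierTransform

theorem integrable_convolution {f g : ℝ → ℝ} (hf : Integrable f) (hg : Integrable g) :
    Integrable (f ⋆ g) :=
  hf.integrable_convolution _ hg

/-- The kernel of `𝓕` is `exp(-2πi τξ)`, so angular frequency is rescaled by `2π`. -/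
theorem cpsd_eq_fourier (f : ℝ → ℝ) (ω : ℝ) :
    cpsd f ω = 𝓕 (fun τ => (f τ : ℂ)) (ω / (2 * Real.pi)) := by
  rw [Real.fourier_real_eq_integral_exp_smul, cpsd]
  congr 1
  ext τ
  rw [smul_eq_mul, mul_comm]
  congr 2
  push_cast
  have : (Real.pi : ℂ) ≠ 0 := by exact_mod_cast Real.pi_ne_zero
  field_simp

theorem cpsd_convolution {f g : ℝ → ℝ} (hf : Integrable f) (hg : Integrable g) (ω : ℝ) :
    cpsd (f ⋆ g) ω = cpsd f ω * cpsd g ω := by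
  have h : (fun τ => ((f ⋆ g) τ : ℂ)) =
      (fun τ => (f τ : ℂ)) ⋆[ContinuousLinearMap.mul ℂ ℂ] fun τ => (g τ : ℂ) := by
    ext τ
    simp [convolution, ← integral_complex_ofReal]
  rw [cpsd_eq_fourier, cpsd_eq_fourier, cpsd_eq_fourier, h]
  exact Real.fourier_mul_convolution_eq hf.ofReal hg.ofReal _

theorem cpsd_comp_neg (f : ℝ → ℝ) (ω : ℝ) :
    cpsd (fun u => f (-u)) ω = (starRingEnd ℂ) (cpsd f ω) := by
  unfold cpsd
  rw [← integral_conj, ← integral_neg_eq_self]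
  refine integral_congr_ae (Eventually.of_forall fun τ => ?_)
  simp [← Complex.exp_conj]

theorem cpsd_sum {l : Type*} [Fintype l] {f : l → ℝ → ℝ} (hf : ∀ j, Integrable (f j)) (ω : ℝ) :
    cpsd (fun τ => ∑ j, f j τ) ω = ∑ j, cpsd (f j) ω := by
  unfold cpsd
  rw [← integral_finsetSum]
  · simp [Finset.sum_mul]
  · intro j _
    refine (hf j).ofReal.mul_bdd (c := 1) (by fun_prop) (Eventually.of_forall fun τ => ?_)
    rw [Complex.norm_exp]
    simp

variable {l H : Type*} [Fintype l] [DecidableEq l]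
  [NormedAddCommGroup H] [InnerProductSpace ℝ H] [CompleteSpace H]

/-- The cross-correlation of two filtered versions of the same uncorrelated noises. -/
theorem inner_sum_integral_smul {W : l → ℝ → H} {Rw : ℝ → ℝ}
    (hW : ∀ j, AEStronglyMeasurable (W j)) {K : ℝ} (hK : ∀ j t, ‖W j t‖ ≤ K)
    (hauto : ∀ j u v, inner ℝ (W j u) (W j v) = Rw (u - v))
    (hcross : ∀ j j', j ≠ j' → ∀ u v, inner ℝ (W j u) (W j' v) = 0)
    {f g : l → ℝ → ℝ} (hf : ∀ j, Integrable (f j)) (hg : ∀ j, Integrable (g j)) (τ : ℝ) :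
    inner ℝ (∑ j, ∫ u, f j (τ - u) • W j u) (∑ j, ∫ v, g j (-v) • W j v) =
      ∑ j, (((fun v => g j (-v)) ⋆ Rw) ⋆ f j) τ := by
  have hfi : ∀ j, Integrable fun u => f j (τ - u) • W j u := fun j =>
    integrable_smul_of_bounded ((hf j).comp_sub_left τ) (hW j) (hK j)
  have hgi : ∀ j, Integrable fun v => g j (-v) • W j v := fun j =>
    integrable_smul_of_bounded (hg j).comp_neg (hW j) (hK j)
  -- The first integration, over `v`, produces the inner convolution; the one over `u` produces the
  -- outer one.
  have hin : ∀ j j' u, inner ℝ (W j u) (∫ v, g j' (-v) • W j' v) =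
      if j = j' then ((fun v => g j (-v)) ⋆ Rw) u else 0 := by
    intro j j' u
    rw [← integral_inner (hgi j')]
    split_ifs with h
    · subst h
      simp [convolution, inner_smul_right, hauto]
    · simp [inner_smul_right, hcross j j' h]
  rw [sum_inner]
  refine Finset.sum_congr rfl fun j _ => ?_
  rw [real_inner_comm, ← integral_inner (hfi j)]
  simp only [convolution, ContinuousLinearMap.lsmul_apply]
  refine integral_congr_ae (Eventually.of_forall fun u => ?_)
  simp only [inner_smul_right]
  rw [real_inner_comm, inner_sum]
  simp only [hin, Finset.sum_ite_eq, Finset.mem_univ, if_true, smul_eq_mul]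
  rw [mul_comm]
  rfl

end Spectra

/-! ### The transfer matrix -/

section TransferMatrix

variable {m : Type*} [Fintype m] [DecidableEq m]

theorem isUnit_det_sub_of_isHurwitz {M : Matrix m m ℝ} (hM : IsHurwitz M) (ω : ℝ) :
    IsUnit ((Complex.I * ω) • (1 : Matrix m m ℂ) - M.map Complex.ofReal).det := by
  by_contra h
  have h' : Complex.I * ω ∈ spectrum ℂ (M.map Complex.ofReal) := by
    rwa [spectrum.mem_iff, Matrix.isUnit_iff_isUnit_det, Algebra.algebraMap_eq_smul_one]
  simpa using hM _ h'

theorem tendsto_flow_apply {M : Matrix m m ℝ} (hM : IsHurwitz M) (p q : m) :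
    Tendsto (fun u => flow M u p q) atTop (𝓝 0) := by
  obtain ⟨K, a, ha, h⟩ := exists_abs_flow_le hM
  have hlim : Tendsto (fun u => K * Real.exp (-a * u)) atTop (𝓝 (K * 0)) := by
    refine (Real.tendsto_exp_atBot.comp ?_).const_mul K
    exact tendsto_id.const_mul_atTop_of_neg (neg_neg_of_pos ha)
  rw [mul_zero] at hlim
  exact squeeze_zero_norm' ((eventually_ge_atTop 0).mono fun u hu => h u hu p q) hlim

/-- The Laplace transform of the flow on the imaginary axis. -/
def flowTransform (M : Matrix m m ℝ) (ω : ℝ) : Matrix m m ℂ :=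
  Matrix.of fun p q =>
    ∫ u in Set.Ioi (0 : ℝ), (flow M u p q : ℂ) * Complex.exp (-(Complex.I * ω * u))

theorem integrableOn_flow_mul_exp {M : Matrix m m ℝ} (hM : IsHurwitz M) (ω : ℝ) (p q : m) :
    IntegrableOn (fun u : ℝ => (flow M u p q : ℂ) * Complex.exp (-(Complex.I * ω * u)))
      (Set.Ioi 0) := by
  have h := integrableOn_flow_apply hM p q
  rw [integrableOn_Ici_iff_integrableOn_Ioi] at h
  refine (Integrable.ofReal h).mul_bdd (c := 1) (by fun_prop) (Eventually.of_forall fun τ => ?_)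
  rw [Complex.norm_exp]
  simp

/-- Integrating the derivative of `exp(uM) e^{-iωu}` over `(0, ∞)` leaves minus its value 1 at `u =
0`, by decay at infinity. -/
theorem mul_flowTransform {M : Matrix m m ℝ} (hM : IsHurwitz M) (ω : ℝ) :
    ((Complex.I * ω) • (1 : Matrix m m ℂ) - M.map Complex.ofReal) * flowTransform M ω = 1 := by
  ext p q
  set z : ℂ := Complex.I * ω with hz
  have hderiv : ∀ u : ℝ, HasDerivAt
      (fun u : ℝ => (flow M u p q : ℂ) * Complex.exp (-(z * u)))
      (∑ r, (M p r : ℂ) * ((flow M u r q : ℂ) * Complex.exp (-(z * u))) -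
        z * ((flow M u p q : ℂ) * Complex.exp (-(z * u)))) u := fun u => by
    have h1 := (hasDerivAt_flow_apply M u p q).ofReal_comp
    have h2 : HasDerivAt (fun u : ℝ => Complex.exp (-(z * u)))
        (Complex.exp (-(z * u)) * -(z * 1)) u :=
      ((Complex.ofRealCLM.hasDerivAt (x := u)).const_mul z).neg.cexp
    refine (h1.mul h2).congr_deriv ?_
    rw [Matrix.mul_apply]
    push_cast
    rw [Finset.sum_mul]
    simp only [mul_assoc]
    ring
  have hint : ∀ r, IntegrableOn
      (fun u : ℝ => (flow M u r q : ℂ) * Complex.exp (-(z * u))) (Set.Ioi 0) := fun r =>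
    integrableOn_flow_mul_exp hM ω r q
  have hlim : Tendsto (fun u : ℝ => (flow M u p q : ℂ) * Complex.exp (-(z * u))) atTop (𝓝 0) := by
    rw [tendsto_zero_iff_norm_tendsto_zero]
    have h := (tendsto_flow_apply hM p q).norm
    rw [norm_zero] at h
    refine h.congr fun u => ?_
    rw [norm_mul, Complex.norm_exp, Complex.norm_real]
    simp [hz]
  have hsum := integrable_finsetSum Finset.univ fun r _ => (hint r).const_mul (M p r : ℂ)
  have hftc := integral_Ioi_of_hasDerivAt_of_tendsto' (a := 0) (fun u _ => hderiv u)
    (hsum.sub ((hint p).const_mul z)) hlim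
  rw [integral_sub hsum ((hint p).const_mul z),
    integral_finsetSum _ fun r _ => (hint r).const_mul (M p r : ℂ)] at hftc
  simp only [integral_const_mul] at hftc
  rw [Matrix.sub_mul, Matrix.smul_mul, Matrix.one_mul, Matrix.sub_apply, Matrix.smul_apply,
    Matrix.mul_apply, smul_eq_mul]
  simp only [flowTransform, Matrix.of_apply, Matrix.map_apply, ← hz]
  rw [← neg_sub, hftc]
  by_cases hpq : p = q <;> simp [flow_zero, Matrix.one_apply, hpq]

theorem cpsd_impulseResponse {k l : Type*} {M : Matrix m m ℝ} (hM : IsHurwitz M)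
    (B : Matrix m l ℝ) (C : Matrix k m ℝ) (i : k) (j : l) (ω : ℝ) :
    cpsd (impulseResponse M B C i j) ω = (C.map Complex.ofReal *
      ((Complex.I * ω) • (1 : Matrix m m ℂ) - M.map Complex.ofReal)⁻¹ *
        B.map Complex.ofReal) i j := by
  rw [Matrix.inv_eq_right_inv (mul_flowTransform hM ω)]
  have hind : ∀ τ : ℝ, (impulseResponse M B C i j τ : ℂ) * Complex.exp (-(Complex.I * ω * τ)) =
      (Set.Ici 0).indicator (fun τ : ℝ => ∑ q, ∑ p, (C i p : ℂ) * ((flow M τ p q : ℂ) *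
        Complex.exp (-(Complex.I * ω * τ))) * (B q j : ℂ)) τ := fun τ => by
    by_cases hτ : τ ∈ Set.Ici (0 : ℝ)
    · simp only [impulseResponse, Set.indicator_of_mem hτ, Matrix.mul_apply]
      push_cast
      simp only [Finset.sum_mul]
      exact Finset.sum_congr rfl fun q _ => Finset.sum_congr rfl fun p _ => by ring
    · simp [impulseResponse, Set.indicator_of_notMem hτ]
  have hint := integrableOn_flow_mul_exp hM ω
  simp only [cpsd, hind]
  rw [integral_indicator measurableSet_Ici, integral_Ici_eq_integral_Ioi,
    integral_finsetSum _ fun q _ => integrable_finsetSum _ fun p _ =>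
      ((hint p q).const_mul _).mul_const _]
  simp only [Matrix.mul_apply, Finset.sum_mul]
  refine Finset.sum_congr rfl fun q _ => ?_
  rw [integral_finsetSum _ fun p _ => ((hint p q).const_mul _).mul_const _]
  refine Finset.sum_congr rfl fun p _ => ?_
  rw [integral_mul_const, integral_const_mul]
  rfl

variable {N n : ℕ}

/-- The input matrix `I_N ⊗ b` of the network. -/
def inputMatrix (N : ℕ) {n : ℕ} (b : Fin n → ℝ) : Matrix (Fin N × Fin n) (Fin N) ℝ :=
  Matrix.of fun p j => if p.1 = j then b p.2 else 0

/-- The output matrix `I_N ⊗ cᵀ` of the network. -/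
def outputMatrix (N : ℕ) {n : ℕ} (c : Fin n → ℝ) : Matrix (Fin N) (Fin N × Fin n) ℝ :=
  Matrix.of fun i p => if p.1 = i then c p.2 else 0

/-- The transfer matrix of the network, from the noises to the outputs. -/
def transferMatrix (A : Matrix (Fin n) (Fin n) ℝ) (b c : Fin n → ℝ)
    (G : Matrix (Fin N) (Fin N) ℝ) (s : ℂ) : Matrix (Fin N) (Fin N) ℂ :=
  (outputMatrix N c).map Complex.ofReal *
    (s • (1 : Matrix (Fin N × Fin n) (Fin N × Fin n) ℂ) -
      (stateMatrix A b c G).map Complex.ofReal)⁻¹ * (inputMatrix N b).map Complex.ofReal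

/-- With `d = (sI - A)⁻¹ b` and `V = I ⊗ d`, one finds `Q V = B (I - hG)` and `C V = h I`.
Eliminating `V` gives `C Q⁻¹ B (I - hG) = h I`; then divide by `h`. -/
theorem transferMatrix_mul {A : Matrix (Fin n) (Fin n) ℝ} {b c : Fin n → ℝ}
    {G : Matrix (Fin N) (Fin N) ℝ} {s : ℂ}
    (hs : IsUnit (s • (1 : Matrix (Fin N × Fin n) (Fin N × Fin n) ℂ) -
      (stateMatrix A b c G).map Complex.ofReal).det)
    (h0 : transferFunction A b c s ≠ 0) :
    transferMatrix A b c G s * ((transferFunction A b c s)⁻¹ • (1 : Matrix (Fin N) (Fin N) ℂ) -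
      G.map Complex.ofReal) = 1 := by
  set h := transferFunction A b c s with hh
  set D := s • (1 : Matrix (Fin n) (Fin n) ℂ) - A.map Complex.ofReal with hD
  set Q := s • (1 : Matrix (Fin N × Fin n) (Fin N × Fin n) ℂ) -
      (stateMatrix A b c G).map Complex.ofReal with hQ
  -- A singular matrix has inverse 0 by convention, which would make `h = 0`. Invertibility thus
  -- comes from `h ≠ 0`, not from stability of the network.
  have hDu : IsUnit D.det := by
    by_contra hns
    refine h0 ?_
    rw [hh, transferFunction, ← hD, Matrix.nonsing_inv_apply_not_isUnit _ hns]
    simp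
  set d : Fin n → ℂ := D⁻¹ *ᵥ fun a => (b a : ℂ) with hd
  have hDd : D *ᵥ d = fun a => (b a : ℂ) := by
    rw [hd, Matrix.mulVec_mulVec, Matrix.mul_nonsing_inv _ hDu, Matrix.one_mulVec]
  have hcd : ∑ a, (c a : ℂ) * d a = h := rfl
  set V : Matrix (Fin N × Fin n) (Fin N) ℂ := Matrix.of fun p j => if p.1 = j then d p.2 else 0
  have hQV : Q * V = (inputMatrix N b).map Complex.ofReal *
      ((1 : Matrix (Fin N) (Fin N) ℂ) - h • G.map Complex.ofReal) := by
    ext ⟨i, a⟩ j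
    have hb := congrFun hDd a
    have e1 : ∀ a', Q (i, a) (j, a') =
        (if i = j then D a a' else 0) - (G i j : ℂ) * (b a * c a') := fun a' => by
      by_cases hij : i = j <;> by_cases haa : a = a' <;>
        simp [hQ, hD, stateMatrix, Matrix.vecMulVec_apply, hij, haa,
          Prod.ext_iff] <;> ring
    have e2 : (Q * V) (i, a) j = ∑ a', Q (i, a) (j, a') * d a' := by
      rw [Matrix.mul_apply, Fintype.sum_prod_type, Finset.sum_eq_single j]
      · simp [V]
      · intro k _ hk
        simp [V, hk]
      · simp
    have e3 : ((inputMatrix N b).map Complex.ofReal *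
        ((1 : Matrix (Fin N) (Fin N) ℂ) - h • G.map Complex.ofReal)) (i, a) j =
        (b a : ℂ) * ((if i = j then 1 else 0) - h * G i j) := by
      rw [Matrix.mul_apply, Finset.sum_eq_single i]
      · simp [inputMatrix, Matrix.one_apply]
      · intro k _ hk
        simp [inputMatrix, hk.symm]
      · simp
    rw [e2, e3]
    simp only [e1, sub_mul, Finset.sum_sub_distrib]
    have e4 : ∑ a', (G i j : ℂ) * (b a * c a') * d a' = G i j * b a * h := by
      rw [← hcd, Finset.mul_sum]
      exact Finset.sum_congr rfl fun a' _ => by ring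
    rw [e4]
    by_cases hij : i = j
    · simp only [hij, if_true]
      have : ∑ a', D a a' * d a' = b a := hb
      rw [this]
      ring
    · simp only [hij, if_false, zero_mul, Finset.sum_const_zero]
      ring
  have hCV : (outputMatrix N c).map Complex.ofReal * V = h • (1 : Matrix (Fin N) (Fin N) ℂ) := by
    ext i j
    rw [Matrix.mul_apply, Fintype.sum_prod_type, Finset.sum_eq_single i]
    · by_cases hij : i = j
      · simp [outputMatrix, V, hij, hcd]
      · simp [outputMatrix, V, hij]
    · intro k _ hk
      simp [outputMatrix, hk]
    · simp
  have hV : V = Q⁻¹ * ((inputMatrix N b).map Complex.ofReal *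
      ((1 : Matrix (Fin N) (Fin N) ℂ) - h • G.map Complex.ofReal)) := by
    rw [← hQV, ← Matrix.mul_assoc, Matrix.nonsing_inv_mul _ hs, Matrix.one_mul]
  have hT : h⁻¹ • (1 : Matrix (Fin N) (Fin N) ℂ) - G.map Complex.ofReal =
      h⁻¹ • (1 - h • G.map Complex.ofReal) := by
    rw [smul_sub, smul_smul, inv_mul_cancel₀ h0, one_smul]
  rw [hT, Matrix.mul_smul, transferMatrix, ← hQ, Matrix.mul_assoc, Matrix.mul_assoc, ← hV, hCV,
    smul_smul, inv_mul_cancel₀ h0, one_smul]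

/-- Inverting the power spectral density matrix. -/
theorem inv_smul_mul_conjTranspose {l : Type*} [Fintype l] [DecidableEq l] {σ : ℂ} (hσ : σ ≠ 0)
    {K T : Matrix l l ℂ} (h : K * T = 1) :
    IsUnit (σ • (K * Kᴴ)).det ∧ (σ • (K * Kᴴ))⁻¹ = σ⁻¹ • (Tᴴ * T) := by
  have hTK : T * K = 1 := mul_eq_one_comm.mp h
  have hinv : (σ • (K * Kᴴ)) * (σ⁻¹ • (Tᴴ * T)) = 1 := by
    rw [Matrix.smul_mul, Matrix.mul_smul, smul_smul, mul_inv_cancel₀ hσ, one_smul,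
      Matrix.mul_assoc, ← Matrix.mul_assoc Kᴴ, ← Matrix.conjTranspose_mul, hTK,
      Matrix.conjTranspose_one, Matrix.one_mul, h]
  exact ⟨Matrix.isUnit_det_of_right_inverse hinv, Matrix.inv_eq_right_inv hinv⟩

theorem im_conjTranspose_mul_self_apply (G : Matrix (Fin N) (Fin N) ℝ) (z : ℂ) (i j : Fin N) :
    (((z • (1 : Matrix (Fin N) (Fin N) ℂ) - G.map Complex.ofReal)ᴴ *
      (z • (1 : Matrix (Fin N) (Fin N) ℂ) - G.map Complex.ofReal)) i j).im =
        z.im * (G i j - G j i) := by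
  have hG : (G.map Complex.ofReal)ᴴ = Gᵀ.map Complex.ofReal := by
    ext
    simp
  have hGG : Gᵀ.map Complex.ofReal * G.map Complex.ofReal = (Gᵀ * G).map Complex.ofReal :=
    (map_mul (Complex.ofRealHom.mapMatrix : Matrix (Fin N) (Fin N) ℝ →+* _) Gᵀ G).symm
  rw [Matrix.conjTranspose_sub, Matrix.conjTranspose_smul, Matrix.conjTranspose_one, hG,
    Matrix.sub_mul, Matrix.mul_sub, Matrix.mul_sub, hGG]
  by_cases hij : i = j
  · subst hij
    simp [Complex.mul_im]
    ring
  · simp [Complex.mul_im, hij]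
    ring

end TransferMatrix

/-! ### Mean-square calculus in `L²` -/

section MeanSquare

variable {S : Type*} [MeasurableSpace S] {P : Measure S}

theorem inner_Lp_eq_integral {f g : Lp ℝ 2 P} {f' g' : S → ℝ} (hf : f =ᵐ[P] f')
    (hg : g =ᵐ[P] g') : inner ℝ f g = ∫ s, f' s * g' s ∂P := by
  rw [L2.inner_def]
  refine integral_congr_ae ?_
  filter_upwards [hf, hg] with s h1 h2
  simp [h1, h2, mul_comm]

theorem coeFn_sum_smul {ι : Type*} [Fintype ι] (a : ι → ℝ) {f : ι → Lp ℝ 2 P} {f' : ι → S → ℝ}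
    (hf : ∀ j, f j =ᵐ[P] f' j) :
    ((∑ j, a j • f j : Lp ℝ 2 P) : S → ℝ) =ᵐ[P] fun s => ∑ j, a j * f' j s := by
  filter_upwards [Lp.coeFn_fun_finsetSum Finset.univ fun j => a j • f j,
    ae_all_iff.mpr fun j => Lp.coeFn_smul (a j) (f j), ae_all_iff.mpr hf] with s h1 h2 h3
  rw [h1]
  exact Finset.sum_congr rfl fun j _ => by rw [h2, Pi.smul_apply, h3, smul_eq_mul]

/-- The expectation in the mean-square limit is the squared `L²` norm of the error of the difference
quotient. -/
theorem HasMeanSquareDerivAt.hasDerivAt {X : ℝ → S → ℝ} {V : S → ℝ} {t : ℝ}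
    (h : HasMeanSquareDerivAt P X V t) {X' : ℝ → Lp ℝ 2 P} (hX : ∀ t, X' t =ᵐ[P] X t)
    {V' : Lp ℝ 2 P} (hV : V' =ᵐ[P] V) : HasDerivAt X' V' t := by
  rw [hasDerivAt_iff_tendsto_slope_zero, tendsto_iff_norm_sub_tendsto_zero]
  have h' := h.sqrt
  rw [Real.sqrt_zero] at h'
  refine h'.congr fun δ => ?_
  rw [← Real.sqrt_sq (norm_nonneg _), ← real_inner_self_eq_norm_sq]
  have hae : (δ⁻¹ • (X' (t + δ) - X' t) - V' : Lp ℝ 2 P) =ᵐ[P]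
      fun s => (X (t + δ) s - X t s) / δ - V s := by
    filter_upwards [Lp.coeFn_sub (δ⁻¹ • (X' (t + δ) - X' t)) V',
      Lp.coeFn_smul δ⁻¹ (X' (t + δ) - X' t), Lp.coeFn_sub (X' (t + δ)) (X' t), hX t,
      hX (t + δ), hV] with s h1 h2 h3 h4 h5 h6
    rw [h1, Pi.sub_apply, h2, Pi.smul_apply, h3, Pi.sub_apply, h4, h5, h6, smul_eq_mul,
      div_eq_inv_mul]
  rw [inner_Lp_eq_integral hae hae]
  simp only [sq]

end MeanSquare

/-! ### The power spectral densities of the network -/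

section Network

variable {N n : ℕ} {S : Type*} [MeasurableSpace S] {P : Measure S}
  {A : Matrix (Fin n) (Fin n) ℝ} {b c : Fin n → ℝ} {G : Matrix (Fin N) (Fin N) ℝ}
  {w : Fin N → ℝ → S → ℝ} {x : Fin N → Fin n → ℝ → S → ℝ} {Rw : ℝ → ℝ}
  {R : Fin N → Fin N → ℝ → ℝ}

theorem sum_stateMatrix_mul (A : Matrix (Fin n) (Fin n) ℝ) (b c : Fin n → ℝ)
    (G : Matrix (Fin N) (Fin N) ℝ) (i : Fin N) (a : Fin n) (v : Fin N → Fin n → ℝ) :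
    ∑ q : Fin N × Fin n, stateMatrix A b c G (i, a) q * v q.1 q.2 =
      (∑ a', A a a' * v i a') + b a * ∑ j, G i j * ∑ a', c a' * v j a' := by
  simp only [stateMatrix, Matrix.add_apply, Matrix.kroneckerMap_apply, Matrix.vecMulVec_apply,
    add_mul, Finset.sum_add_distrib, Fintype.sum_prod_type]
  congr 1
  · rw [Finset.sum_eq_single i]
    · simp
    · intro j _ hj
      simp [hj.symm]
    · simp
  · simp only [Finset.mul_sum]
    exact Finset.sum_congr rfl fun j _ => Finset.sum_congr rfl fun a' _ => by ring

/-- The state of the network as a curve in `L²`. -/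
def IsSolution.stateLp (hx : IsSolution P A b c G w x) (p : Fin N × Fin n) (t : ℝ) : Lp ℝ 2 P :=
  (hx.memLp p.1 p.2 t).toLp

/-- The noise as a curve in `L²`. -/
def IsNoise.noiseLp (hw : IsNoise P w Rw) (j : Fin N) (t : ℝ) : Lp ℝ 2 P :=
  (hw.memLp j t).toLp

theorem IsSolution.coeFn_stateLp (hx : IsSolution P A b c G w x) (p : Fin N × Fin n) (t : ℝ) :
    hx.stateLp p t =ᵐ[P] x p.1 p.2 t :=
  (hx.memLp p.1 p.2 t).coeFn_toLp

theorem IsNoise.coeFn_noiseLp (hw : IsNoise P w Rw) (j : Fin N) (t : ℝ) :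
    hw.noiseLp j t =ᵐ[P] w j t :=
  (hw.memLp j t).coeFn_toLp

theorem IsNoise.inner_noiseLp_self (hw : IsNoise P w Rw) (j : Fin N) (u v : ℝ) :
    inner ℝ (hw.noiseLp j u) (hw.noiseLp j v) = Rw (u - v) := by
  rw [inner_Lp_eq_integral (hw.coeFn_noiseLp j u) (hw.coeFn_noiseLp j v),
    ← hw.autocorrelation j u (u - v), sub_sub_cancel]

theorem IsNoise.inner_noiseLp_of_ne (hw : IsNoise P w Rw) {i j : Fin N} (hij : i ≠ j) (u v : ℝ) :
    inner ℝ (hw.noiseLp i u) (hw.noiseLp j v) = 0 := by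
  rw [inner_Lp_eq_integral (hw.coeFn_noiseLp i u) (hw.coeFn_noiseLp j v),
    hw.uncorrelated i j hij u v]

theorem IsNoise.norm_noiseLp (hw : IsNoise P w Rw) (j : Fin N) (t : ℝ) :
    ‖hw.noiseLp j t‖ = √(Rw 0) := by
  rw [norm_eq_sqrt_real_inner, hw.inner_noiseLp_self, sub_self]

theorem IsNoise.autocorrelation_neg (hw : IsNoise P w Rw) (j : Fin N) (τ : ℝ) :
    Rw (-τ) = Rw τ := by
  rw [← zero_sub, ← hw.inner_noiseLp_self j, real_inner_comm, hw.inner_noiseLp_self, sub_zero]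

theorem IsSolution.hasDerivAt_stateLp (hx : IsSolution P A b c G w x) (hw : IsNoise P w Rw)
    (p : Fin N × Fin n) (t : ℝ) :
    HasDerivAt (hx.stateLp p) (∑ q, stateMatrix A b c G p q • hx.stateLp q t +
      ∑ j, inputMatrix N b p j • hw.noiseLp j t) t := by
  refine (hx.hasDeriv p.1 p.2 t).hasDerivAt (hx.coeFn_stateLp p) ?_
  filter_upwards [Lp.coeFn_add (∑ q, stateMatrix A b c G p q • hx.stateLp q t)
      (∑ j, inputMatrix N b p j • hw.noiseLp j t),
    coeFn_sum_smul (stateMatrix A b c G p) fun q => hx.coeFn_stateLp q t,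
    coeFn_sum_smul (inputMatrix N b p) fun j => hw.coeFn_noiseLp j t] with s h1 h2 h3
  rw [h1, Pi.add_apply, h2, h3]
  have h4 : ∑ j, inputMatrix N b p j * w j t s = b p.2 * w p.1 t s := by
    simp [inputMatrix]
  rw [h4, sum_stateMatrix_mul A b c G p.1 p.2 fun i a => x i a t s]
  simp only [output]
  ring

/-- Stationarity alone gives no regularity in time. The equation does: where `b` has a nonzero
entry, the noise is a combination of a derivative and continuous curves. -/
theorem IsSolution.aestronglyMeasurable_noiseLp (hx : IsSolution P A b c G w x)
    (hw : IsNoise P w Rw) (hb : b ≠ 0) (j : Fin N) : AEStronglyMeasurable (hw.noiseLp j) := by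
  obtain ⟨a, ha⟩ := Function.ne_iff.mp hb
  have hcont : ∀ q, Continuous (hx.stateLp q) := fun q =>
    continuous_iff_continuousAt.mpr fun t => (hx.hasDerivAt_stateLp hw q t).continuousAt
  have hrep : hw.noiseLp j = fun t => (b a)⁻¹ • (deriv (hx.stateLp (j, a)) t -
      ∑ q, stateMatrix A b c G (j, a) q • hx.stateLp q t) := by
    funext t
    have : ∑ k, inputMatrix N b (j, a) k • hw.noiseLp k t = b a • hw.noiseLp j t := by
      simp [inputMatrix]
    rw [(hx.hasDerivAt_stateLp hw (j, a) t).deriv, add_sub_cancel_left, this, smul_smul,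
      inv_mul_cancel₀ ha, one_smul]
  have hsum : Continuous fun t => ∑ q, stateMatrix A b c G (j, a) q • hx.stateLp q t :=
    continuous_finsetSum _ fun q _ => (hcont q).fun_const_smul _
  rw [hrep]
  exact ((stronglyMeasurable_deriv (hx.stateLp (j, a))).aestronglyMeasurable.sub
    hsum.aestronglyMeasurable).const_smul (b a)⁻¹

theorem IsSolution.inner_outputLp (hx : IsSolution P A b c G w x)
    (hR : ∀ i j, IsCrossCorrelation P (output c x i) (output c x j) (R i j)) (i j : Fin N)
    (t t' : ℝ) :
    inner ℝ (∑ p, outputMatrix N c i p • hx.stateLp p t)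
      (∑ p, outputMatrix N c j p • hx.stateLp p t') = R i j (t - t') := by
  have hout : ∀ i t, ((∑ p, outputMatrix N c i p • hx.stateLp p t : Lp ℝ 2 P) : S → ℝ)
      =ᵐ[P] output c x i t := fun i t => by
    filter_upwards [coeFn_sum_smul (outputMatrix N c i) fun p => hx.coeFn_stateLp p t] with s hs
    rw [hs, Fintype.sum_prod_type, Finset.sum_eq_single i]
    · simp [outputMatrix, output]
    · intro k _ hk
      simp [outputMatrix, hk]
    · simp
  rw [inner_Lp_eq_integral (hout i t) (hout j t'), ← hR i j t (t - t'), sub_sub_cancel]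

open scoped Convolution in
theorem IsSolution.crossCorrelation_eq (hstable : IsHurwitz (stateMatrix A b c G))
    (hx : IsSolution P A b c G w x) (hw : IsNoise P w Rw) (hb : b ≠ 0)
    (hR : ∀ i j, IsCrossCorrelation P (output c x i) (output c x j) (R i j)) (i j : Fin N) :
    R i j = fun τ => ∑ l,
      (((fun v => impulseResponse (stateMatrix A b c G) (inputMatrix N b) (outputMatrix N c) j l
        (-v)) ⋆ Rw) ⋆
        impulseResponse (stateMatrix A b c G) (inputMatrix N b) (outputMatrix N c) i l) τ := by
  have hmeas := hx.aestronglyMeasurable_noiseLp hw hb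
  have hbound : ∀ j t, ‖hw.noiseLp j t‖ ≤ √(Rw 0) := fun j t => (hw.norm_noiseLp j t).le
  have hout : ∀ i t, ∑ p, outputMatrix N c i p • hx.stateLp p t = ∑ l, ∫ u,
      impulseResponse (stateMatrix A b c G) (inputMatrix N b) (outputMatrix N c) i l (t - u) •
        hw.noiseLp l u := fun i t =>
    output_eq_integral_impulseResponse hstable _ _ (hx.hasDerivAt_stateLp hw) hmeas hbound i
      -- Here the steady state enters: the `L²` norm of the output does not depend on time.
      (L := √(R i i 0)) (fun t => by
        rw [norm_eq_sqrt_real_inner, hx.inner_outputLp hR, sub_self]) t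
  funext τ
  rw [← inner_sum_integral_smul hmeas hbound hw.inner_noiseLp_self
    (fun _ _ h => hw.inner_noiseLp_of_ne h)
    (integrable_impulseResponse hstable _ _ i) (integrable_impulseResponse hstable _ _ j) τ,
    ← sub_zero τ, ← hx.inner_outputLp hR i j τ 0, hout, hout]
  simp only [sub_zero, zero_sub]

theorem IsSolution.integrable_crossCorrelation (hstable : IsHurwitz (stateMatrix A b c G))
    (hx : IsSolution P A b c G w x) (hw : IsNoise P w Rw) (hb : b ≠ 0) (hRw : Integrable Rw)
    (hR : ∀ i j, IsCrossCorrelation P (output c x i) (output c x j) (R i j)) (i j : Fin N) :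
    Integrable (R i j) := by
  rw [hx.crossCorrelation_eq hstable hw hb hR i j]
  exact integrable_finsetSum _ fun l _ => integrable_convolution
    (integrable_convolution (integrable_impulseResponse hstable _ _ j l).comp_neg hRw)
    (integrable_impulseResponse hstable _ _ i l)

/-- Each convolution becomes a product, and the time-reversed impulse response contributes the
complex conjugate, hence `Kᴴ`. -/
theorem IsSolution.cpsdMatrix_eq (hstable : IsHurwitz (stateMatrix A b c G))
    (hx : IsSolution P A b c G w x) (hw : IsNoise P w Rw) (hb : b ≠ 0) (hRw : Integrable Rw)
    (hR : ∀ i j, IsCrossCorrelation P (output c x i) (output c x j) (R i j)) (ω : ℝ) :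
    cpsdMatrix R ω = (psd Rw ω : ℂ) • (transferMatrix A b c G (Complex.I * ω) *
      (transferMatrix A b c G (Complex.I * ω))ᴴ) := by
  ext i j
  rw [cpsdMatrix, Matrix.of_apply, hx.crossCorrelation_eq hstable hw hb hR i j, cpsd_sum,
    ← cpsd_eq_psd Rw (hw.autocorrelation_neg i) ω, Matrix.smul_apply, Matrix.mul_apply,
    smul_eq_mul, Finset.mul_sum]
  · refine Finset.sum_congr rfl fun l _ => ?_
    have hj := (integrable_impulseResponse hstable (inputMatrix N b) (outputMatrix N c) j l)
    rw [cpsd_convolution (integrable_convolution hj.comp_neg hRw)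
        (integrable_impulseResponse hstable _ _ i l),
      cpsd_convolution hj.comp_neg hRw, cpsd_comp_neg, cpsd_impulseResponse hstable,
      cpsd_impulseResponse hstable, Matrix.conjTranspose_apply]
    change (starRingEnd ℂ) (transferMatrix A b c G (Complex.I * ω) j l) * _ *
      transferMatrix A b c G (Complex.I * ω) i l = _
    rw [starRingEnd_apply]
    ring
  · exact fun l => integrable_convolution
      (integrable_convolution (integrable_impulseResponse hstable _ _ j l).comp_neg hRw)
      (integrable_impulseResponse hstable _ _ i l)

theorem mul_apply_swap_eq_zero (hnonneg : ∀ i j, 0 ≤ G i j) (htr : (G ^ 2).trace = 0)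
    (i j : Fin N) : G i j * G j i = 0 := by
  rw [sq, Matrix.trace] at htr
  simp only [Matrix.diag_apply, Matrix.mul_apply] at htr
  have h0 : ∀ i j, 0 ≤ G i j * G j i := fun i j => mul_nonneg (hnonneg i j) (hnonneg j i)
  have h1 := (Finset.sum_eq_zero_iff_of_nonneg
    fun i _ => Finset.sum_nonneg fun j _ => h0 i j).mp htr i (Finset.mem_univ i)
  exact (Finset.sum_eq_zero_iff_of_nonneg fun j _ => h0 i j).mp h1 j (Finset.mem_univ j)

end Network

end

end LTINetwork

/-! ### Recovery of the coupling matrix from the output spectra -/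

theorem theorem3 {N n : ℕ}
    (A : Matrix (Fin n) (Fin n) ℝ) (b c : Fin n → ℝ) (G : Matrix (Fin N) (Fin N) ℝ)
    (hstable : LTINetwork.IsHurwitz (LTINetwork.stateMatrix A b c G))
    (hnonneg : ∀ i j, 0 ≤ G i j) (hnonreciprocal : (G ^ 2).trace = 0)
    {S : Type*} [MeasurableSpace S] (P : MeasureTheory.Measure S)
    [MeasureTheory.IsProbabilityMeasure P]
    (w : Fin N → ℝ → S → ℝ) (Rw : ℝ → ℝ) (hA1 : LTINetwork.IsNoise P w Rw)
    (Ω : ℝ) (hA2 : LTINetwork.IsExcitationInterval Rw Ω)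
    (x : Fin N → Fin n → ℝ → S → ℝ) (hx : LTINetwork.IsSolution P A b c G w x)
    (R : Fin N → Fin N → ℝ → ℝ)
    (hR : ∀ i j, LTINetwork.IsCrossCorrelation P
      (LTINetwork.output c x i) (LTINetwork.output c x j) (R i j))
    (ω : ℝ) (hω : ω ∈ Set.Ioo (-Ω) Ω)
    (hh : ((LTINetwork.transferFunction A b c (Complex.I * ω))⁻¹).im ≠ 0) :
    (∀ i j, MeasureTheory.Integrable (R i j)) ∧
    IsUnit (LTINetwork.cpsdMatrix R ω).det ∧
    G - Gᵀ = (LTINetwork.psd Rw ω / ((LTINetwork.transferFunction A b c (Complex.I * ω))⁻¹).im) •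
      ((LTINetwork.cpsdMatrix R ω)⁻¹).map Complex.im ∧
    ∀ i j, i ≠ j →
      G i j = max (LTINetwork.psd Rw ω * (((LTINetwork.cpsdMatrix R ω)⁻¹ i j).im /
        ((LTINetwork.transferFunction A b c (Complex.I * ω))⁻¹).im)) 0 := by
  set h := LTINetwork.transferFunction A b c (Complex.I * ω) with hh_def
  -- Because `0⁻¹ = 0`, the condition on `Im h⁻¹` already forces `h ≠ 0`, and with it `b ≠ 0`.
  have h0 : h ≠ 0 := fun h0 => hh (by simp [h0])
  have hb : b ≠ 0 := by
    rintro rfl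
    refine h0 ?_
    have hz : (fun a : Fin n => (((0 : Fin n → ℝ) a : ℝ) : ℂ)) = 0 := by
      ext
      simp
    rw [hh_def, LTINetwork.transferFunction, hz]
    simp
  have hRw := hA2.integrable
  have hpos : 0 < LTINetwork.psd Rw ω := hA2.psd_pos ω hω
  have hpos' : (LTINetwork.psd Rw ω : ℂ) ≠ 0 := by exact_mod_cast hpos.ne'
  obtain ⟨hunit, hinv⟩ := LTINetwork.inv_smul_mul_conjTranspose hpos'
    (LTINetwork.transferMatrix_mul (LTINetwork.isUnit_det_sub_of_isHurwitz hstable ω) h0)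
  rw [← hx.cpsdMatrix_eq hstable hA1 hb hRw hR ω] at hunit hinv
  have him : ∀ i j, ((LTINetwork.cpsdMatrix R ω)⁻¹ i j).im =
      (LTINetwork.psd Rw ω)⁻¹ * (h⁻¹.im * (G i j - G j i)) := fun i j => by
    rw [hinv, Matrix.smul_apply, smul_eq_mul, ← Complex.ofReal_inv, Complex.im_ofReal_mul,
      LTINetwork.im_conjTranspose_mul_self_apply]
  refine ⟨hx.integrable_crossCorrelation hstable hA1 hb hRw hR, hunit, ?_, fun i j _ => ?_⟩
  · ext i j
    rw [Matrix.sub_apply, Matrix.transpose_apply, Matrix.smul_apply, Matrix.map_apply, him,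
      smul_eq_mul]
    generalize h⁻¹.im = z at hh
    field_simp
  · have hdiff : LTINetwork.psd Rw ω * (((LTINetwork.cpsdMatrix R ω)⁻¹ i j).im / h⁻¹.im) =
        G i j - G j i := by
      rw [him]
      generalize h⁻¹.im = z at hh
      field_simp
    rw [hdiff]
    -- If `g_ij = 0`, the difference is nonpositive and the maximum is 0; if `g_ji = 0`, the
    -- difference is `g_ij` itself.
    rcases mul_eq_zero.mp (LTINetwork.mul_apply_swap_eq_zero hnonneg hnonreciprocal i j)
      with h1 | h1
    · rw [h1, max_eq_right (by linarith [hnonneg j i])]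
    · rw [h1, sub_zero, max_eq_left (hnonneg i j)]
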